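/- Let $\Gamma^3=(V,L)$ be the Cayley tree of order $3$, that is, the (infinite) connected graph without cycles in which every vertex has exactly $4$ neighbours. Spins take values in $[0,1]$, configurations are the elements $\sigma$ of $\Omega=[0,1]^V$ with the $\sigma$-algebra generated by the cylinder sets, and the a priori measure on $[0,1]^\Lambda$, for finite $\Lambda\subset V$, is the product $\lambda_\Lambda$ of Lebesgue measures. For $\beta>0$ consider the formal Hamiltonian $$H(\sigma)=-\frac1\beta\sum_{\langle x,y\rangle\in L}\ln\left(1+\frac12\sqrt[7]{4\left(\sigma(x)-\tfrac12\right)\left(\sigma(y)-\tfrac12\right)}\right),$$ where $\sqrt[7]{\cdot}$ is the real seventh root, which is odd on $\mathbb R$, and each unordered edge is counted once. For finite $\Lambda\subset V$, $\eta\in[0,1]^\Lambda$ and $\omega\in\Omega$ let $\eta\omega$ be the configuration equal to $\eta$ on $\Lambda$ and to $\omega$ off $\Lambda$, and let $H_\Lambda(\eta\,\|\,\omega)$ be the part of the sum $H(\eta\omega)$ over the edges with at least one end in $\Lambda$. Let $\nu^\Lambda_\omega$ be the law of $\eta\omega$ when $\eta$ has the density $Z_\Lambda(\omega)^{-1}\exp(-\beta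 H_\Lambda(\eta\,\|\,\omega))$ with respect to $\lambda_\Lambda$, where $Z_\Lambda(\omega)$ is the normalizing constant. A probability measure $\mu$ on $\Omega$ is a Gibbs measure if it satisfies the DLR equations $\mu(A)=\int_\Omega \nu^\Lambda_\omega(A)\,\mu(d\omega)$ for all finite $\Lambda\subset V$ and all measurable $A\subset\Omega$. It is called translation-invariant if it is invariant under the action on $\Omega$ of all automorphisms of $\Gamma^3$ (in particular, under the translations of the tree given by any group representation of it). Theorem. For every $\beta>0$ this model has at least two distinct translation-invariant Gibbs measures. -/

import Mathlib

open MeasureTheory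

noncomputable section

/-- A Cayley tree of order `k`: a connected graph without cycles in which exactly `k + 1` edges are
incident to each vertex. -/
def IsCayleyTree {V : Type*} (k : ℕ) (G : SimpleGraph V) [G.LocallyFinite] : Prop :=
  G.IsTree ∧ G.IsRegularOfDegree (k + 1)

/-- The energy of a nearest-neighbour pair of spins with values in `[0,1]`: a symmetric, bounded,
measurable function. -/
structure PairPotential where
  energy : unitInterval → unitInterval → ℝ
  symm : ∀ t u, energy t u = energy u t
  measurable : Measurable (fun p : unitInterval × unitInterval => energy p.1 p.2)
  bounded : ∃ C : ℝ, ∀ t u, |energy t u| ≤ C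

/-- The energy of the configuration `σ` on the (unoriented) edge `e`. -/
def PairPotential.edgeEnergy {V : Type*} (U : PairPotential) (σ : V → unitInterval) (e : Sym2 V) :
    ℝ :=
  Sym2.lift ⟨fun x y => U.energy (σ x) (σ y), fun x y => U.symm (σ x) (σ y)⟩ e

/-- The part of the formal Hamiltonian `H(σ) = ∑_{⟨x,y⟩} U(σ(x),σ(y))` which involves the spins
in the finite set `Λ`: the sum over all edges with at least one end in `Λ`. When `Λ` is a
ball `V_n` these are the edges inside `V_n` and the edges between `V_n` and the
sphere `W_{n+1}`. -/
def PairPotential.hamiltonian {V : Type*} (U : PairPotential) (G : SimpleGraph V)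
    [G.LocallyFinite] (Λ : Finset V) (σ : V → unitInterval) : ℝ :=
  open Classical in ∑ e ∈ Λ.biUnion (fun x => G.incidenceFinset x), U.edgeEnergy σ e

/-- The configuration that equals `η` on `Λ` and `ω` off `Λ`. -/
def glue {V : Type*} (Λ : Finset V) (η : Λ → unitInterval) (ω : V → unitInterval) :
    V → unitInterval :=
  open Classical in fun x => if h : x ∈ Λ then η ⟨x, h⟩ else ω x

/-- Gluing is a measurable function of the configuration inside, so that the push-forward in
`PairPotential.kernel` is a genuine one. -/
theorem measurable_glue {V : Type*} (Λ : Finset V) (ω : V → unitInterval) :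
    Measurable (fun η : Λ → unitInterval => glue Λ η ω) := by
  refine measurable_pi_lambda _ fun x => ?_
  by_cases h : x ∈ Λ
  · simpa [glue, h] using measurable_pi_apply (⟨x, h⟩ : Λ)
  · simp [glue, h]

/-- The a priori measure on configurations in `Λ`: the product of Lebesgue measures on `[0,1]`. -/
def aprioriMeasure {V : Type*} (Λ : Finset V) : Measure (Λ → unitInterval) :=
  Measure.pi fun _ => volume

/-- The Boltzmann weight `exp(-β H(η ‖ ω))` of the configuration `η` in `Λ` with boundary
condition `ω`. -/
def PairPotential.weight {V : Type*} (U : PairPotential) (G : SimpleGraph V) [G.LocallyFinite]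
    (β : ℝ) (Λ : Finset V) (ω : V → unitInterval) (η : Λ → unitInterval) : ENNReal :=
  ENNReal.ofReal (Real.exp (-β * U.hamiltonian G Λ (glue Λ η ω)))

/-- The partition function in `Λ` with boundary condition `ω`. -/
def PairPotential.partitionFunction {V : Type*} (U : PairPotential) (G : SimpleGraph V)
    [G.LocallyFinite] (β : ℝ) (Λ : Finset V) (ω : V → unitInterval) : ENNReal :=
  ∫⁻ η, U.weight G β Λ ω η ∂(aprioriMeasure Λ)

/-- The conditional Gibbs distribution in `Λ` with boundary condition `ω`: inside `Λ` the
configuration has density `Z⁻¹ exp(-β H(η ‖ ω))` with respect to the a priori measure, and it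
equals `ω` outside `Λ`. -/
def PairPotential.kernel {V : Type*} (U : PairPotential) (G : SimpleGraph V) [G.LocallyFinite]
    (β : ℝ) (Λ : Finset V) (ω : V → unitInterval) : Measure (V → unitInterval) :=
  ((aprioriMeasure Λ).withDensity
    (fun η => (U.partitionFunction G β Λ ω)⁻¹ * U.weight G β Λ ω η)).map
      (fun η => glue Λ η ω)

/-- Gibbs measures at inverse temperature `β`: probability measures on `[0,1]^V` (with the
σ-algebra generated by the cylinder sets) satisfying the DLR equations for all finite `Λ`. -/
def PairPotential.IsGibbsMeasure {V : Type*} (U : PairPotential) (G : SimpleGraph V)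
    [G.LocallyFinite] (β : ℝ) (μ : Measure (V → unitInterval)) : Prop :=
  IsProbabilityMeasure μ ∧
    ∀ (Λ : Finset V) (A : Set (V → unitInterval)), MeasurableSet A →
      μ A = ∫⁻ ω, U.kernel G β Λ ω A ∂μ

/-- Invariance of a measure on configurations under all automorphisms of the graph. For the Cayley
tree this contains the invariance under the translations of any group representation of it. -/
def IsTranslationInvariant {V : Type*} (G : SimpleGraph V) (μ : Measure (V → unitInterval)) :
    Prop :=
  ∀ φ : G ≃g G, μ.map (fun σ x => σ (φ x)) = μ

/-- The real seventh root, an odd function on `ℝ`. -/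
def seventhRoot (x : ℝ) : ℝ := Real.sign x * |x| ^ (1 / 7 : ℝ)

theorem seventhRoot_pow (x : ℝ) : seventhRoot x ^ 7 = x := by
  have h : (|x| ^ (1 / 7 : ℝ)) ^ 7 = |x| := by
    rw [← Real.rpow_natCast, ← Real.rpow_mul (abs_nonneg x)]
    norm_num
  rw [seventhRoot, mul_pow, h]
  rcases lt_trichotomy x 0 with hx | hx | hx
  · rw [Real.sign_of_neg hx, abs_of_neg hx]; ring
  · simp [hx]
  · rw [Real.sign_of_pos hx, abs_of_pos hx]; ring

theorem measurable_seventhRoot : Measurable seventhRoot := by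
  have h : Measurable Real.sign :=
    Measurable.ite measurableSet_Iio measurable_const
      (Measurable.ite measurableSet_Ioi measurable_const measurable_const)
  unfold seventhRoot
  fun_prop

/-- The function `1 + (1/2) * (4 (t - 1/2) (u - 1/2))^(1/7)`. -/
def modelK (t u : unitInterval) : ℝ :=
  1 + 1 / 2 * seventhRoot (4 * ((t : ℝ) - 1 / 2) * ((u : ℝ) - 1 / 2))

theorem modelK_mem (t u : unitInterval) : modelK t u ∈ Set.Icc (1 / 2 : ℝ) (3 / 2) := by
  have h7 := seventhRoot_pow (4 * ((t : ℝ) - 1 / 2) * ((u : ℝ) - 1 / 2))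
  have hb : |4 * ((t : ℝ) - 1 / 2) * ((u : ℝ) - 1 / 2)| ≤ 1 := by
    obtain ⟨t, ht0, ht1⟩ := t
    obtain ⟨u, hu0, hu1⟩ := u
    rw [abs_le]
    constructor <;> dsimp only <;>
      nlinarith [mul_nonneg ht0 hu0, mul_nonneg ht0 (sub_nonneg.2 hu1),
        mul_nonneg hu0 (sub_nonneg.2 ht1), mul_nonneg (sub_nonneg.2 ht1) (sub_nonneg.2 hu1)]
  have h : |seventhRoot (4 * ((t : ℝ) - 1 / 2) * ((u : ℝ) - 1 / 2))| ≤ 1 := by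
    rw [← h7, abs_pow] at hb
    exact (pow_le_one_iff_of_nonneg (abs_nonneg _) (by norm_num)).1 hb
  rw [abs_le] at h
  constructor <;> unfold modelK <;> linarith [h.1, h.2]

/-- The pair energy `-(1/β) ln (1 + (1/2) * (4 (t - 1/2) (u - 1/2))^(1/7))`. -/
def modelPotential (β : ℝ) : PairPotential where
  energy t u := -(1 / β) * Real.log (modelK t u)
  symm t u := by
    have h : modelK t u = modelK u t := by
      unfold modelK
      congr 3
      ring
    rw [h]
  measurable := by
    have := measurable_seventhRoot
    unfold modelK
    fun_prop
  bounded := by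
    refine ⟨|-(1 / β)| * 1, fun t u => ?_⟩
    rw [abs_mul]
    refine mul_le_mul_of_nonneg_left ?_ (abs_nonneg _)
    obtain ⟨h1, h2⟩ := modelK_mem t u
    have hpos : 0 < modelK t u := by linarith
    have hu := Real.log_le_sub_one_of_pos hpos
    have hl := Real.log_le_log (by norm_num) h1
    have h12 : Real.log (1 / 2 : ℝ) = -Real.log 2 := by
      rw [one_div, Real.log_inv]
    have hlog2 := Real.log_two_lt_d9
    rw [abs_le]
    constructor <;> linarith

end

/-!
The interaction is `exp(-β U(t,u)) = K(t,u) = 1 + ψ(t) ψ(u) / 2`, where `ψ(t)` is the real seventh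
root of `2 t - 1` (`modelSpin`), an odd function about `1/2`. A positive function `b` on `[0,1]` with
`∫ K(t,u) b(u)³ du = κ b(t)` is a translation-invariant boundary law: `b` is the message that each
vertex of the tree sends along an edge, having received it along its three other edges. Since `K` has
rank two, every boundary law has the form `b = 1 + a ψ` up to a factor. The odd moments of `ψ`
vanish, `∫ ψ² = 7/9` and `∫ ψ⁴ = 7/11`, so the equation becomes `133 a³ = 11 a`
(`modelBoundaryLaw`); the solutions `a = 0` and `a = √(11/133)` give two boundary laws.

Every boundary law on a Cayley tree has a splitting measure, whose restriction to a finite connected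
set `S` has a density proportional to the product of the Boltzmann factors of the edges inside `S` and
of one factor `b(σ(x))` for each edge that leaves `S` at `x` (`BoundaryLaw.density`). The boundary law
says that integrating out a leaf of `S` gives the density of the smaller set
(`BoundaryLaw.lmarginal_density_insert`), and any connected set grows to a larger one by leaves; so
the densities are consistent, and compactness of the space of probability measures on `[0,1]^V` yields
a measure with these marginals (`BoundaryLaw.exists_isSplittingMeasure`). The marginals determine it
and their description is invariant under automorphisms, hence so is the measure. It is a Gibbs
measure (`BoundaryLaw.IsSplittingMeasure.isGibbsMeasure`), because on a connected set that contains
`Λ` and its neighbours the density is the Boltzmann weight of `Λ` times a function of the spins off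
`Λ`.

The two splitting measures differ in the expectation of `1 + ψ(σ(x))`, which equals `1` for `a = 0`
and exceeds `1` for `a > 0` (`lintegral_one_add_modelSpin`).

Integrals over finitely many spins are written with `MeasureTheory.lmarginal`, so that all functions
live on the full configuration space.
-/

open scoped ENNReal

/-! ### Finite connected subsets of a tree -/

/-- If `T` is connected and `S` is a nonempty proper subset of `T`, then `T` has a vertex off `S` that
is adjacent to a vertex of `S`. -/
theorem SimpleGraph.exists_adj_of_connected_ssubset {V : Type*} {G : SimpleGraph V}
    {S T : Finset V} (hS : S.Nonempty) (hT : (G.induce (T : Set V)).Connected) (hST : S ⊂ T) :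
    ∃ x ∈ S, ∃ y ∈ T, y ∉ S ∧ G.Adj x y := by
  obtain ⟨s, hs⟩ := hS
  obtain ⟨t, ht, hts⟩ := Finset.exists_of_ssubset hST
  obtain ⟨p⟩ := hT.preconnected ⟨s, hST.1 hs⟩ ⟨t, ht⟩
  obtain ⟨d, -, h1, h2⟩ := p.exists_boundary_dart {v | (v : V) ∈ S} hs hts
  exact ⟨d.fst, h1, d.snd, d.snd.2, h2, d.adj⟩

open Classical in
theorem SimpleGraph.connected_induce_insert {V : Type*} {G : SimpleGraph V} {S : Finset V}
    (hS : (G.induce (S : Set V)).Connected) {x y : V} (hx : x ∈ S) (hxy : G.Adj x y) :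
    (G.induce ((insert y S : Finset V) : Set V)).Connected := by
  have h := G.induce_union_connected hS.preconnected
    (G.induce_pair_connected_of_adj hxy).preconnected ⟨x, hx, by simp⟩
  have e : ((insert y S : Finset V) : Set V) = (S : Set V) ∪ {x, y} := by
    ext z
    simp only [Finset.coe_insert, Set.mem_insert_iff, Finset.mem_coe, Set.mem_union,
      Set.mem_singleton_iff]
    constructor
    · tauto
    · rintro (h | rfl | h) <;> tauto
  rwa [e]

/-- In a forest a vertex off a connected set has at most one neighbour in it. -/
theorem SimpleGraph.IsAcyclic.eq_of_adj_connected {V : Type*} {G : SimpleGraph V}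
    (hG : G.IsAcyclic) {S : Set V} (hS : (G.induce S).Connected) {x x' y : V}
    (hx : x ∈ S) (hx' : x' ∈ S) (hy : y ∉ S) (hxy : G.Adj x y) (hxy' : G.Adj x' y) : x' = x := by
  obtain ⟨p, hp⟩ := (hS.preconnected ⟨x, hx⟩ ⟨x', hx'⟩).exists_isPath
  have hq : (p.map (SimpleGraph.Embedding.induce S).toHom).IsPath :=
    hp.map Subtype.val_injective
  have hyq : y ∉ (p.map (SimpleGraph.Embedding.induce S).toHom).support := by
    rw [SimpleGraph.Walk.support_map]
    intro h
    obtain ⟨z, -, rfl⟩ := List.mem_map.1 h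
    exact hy z.2
  have h1 := hG.eq_snd_of_adj_start (hq.cons (h := hxy.symm) hyq) hxy'.symm
    (by simp)
  exact h1.trans (SimpleGraph.Walk.snd_cons _ _)

/-- A connected locally finite graph has countably many vertices. -/
theorem SimpleGraph.Connected.countable_of_locallyFinite {V : Type*} {G : SimpleGraph V}
    [G.LocallyFinite] (hG : G.Connected) : Countable V := by
  obtain ⟨r⟩ := hG.nonempty
  have h : ∀ n : ℕ, {v | ∃ p : G.Walk v r, p.length = n}.Countable := by
    intro n
    induction n with
    | zero =>
      refine (Set.countable_singleton r).mono ?_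
      rintro v ⟨p, hp⟩
      exact SimpleGraph.Walk.eq_of_length_eq_zero hp
    | succ n ih =>
      refine (ih.biUnion fun u _ => (G.neighborFinset u).countable_toSet).mono ?_
      rintro v ⟨p, hp⟩
      cases p with
      | nil => simp at hp
      | cons h q => exact Set.mem_biUnion ⟨q, by simpa using hp⟩ (by simpa using h.symm)
  refine Set.countable_univ_iff.1 ((Set.countable_iUnion h).mono fun v _ => ?_)
  obtain ⟨p⟩ := hG.preconnected v r
  exact Set.mem_iUnion.2 ⟨p.length, p, rfl⟩

/-! ### Integrating out finitely many coordinates -/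

section lmarginal

variable {V : Type*} [DecidableEq V] {X : Type*}

theorem dependsOn_comp_updateFinset {β : Type*} {S T : Finset V} {f : (V → X) → β}
    (hf : DependsOn f (S : Set V)) (hST : Disjoint S T) (ω : V → X) (η : T → X) :
    f (Function.updateFinset ω T η) = f ω := by
  refine hf fun i hi => ?_
  simp [Function.updateFinset, Finset.disjoint_left.1 hST hi]

variable [MeasurableSpace X] {μ : V → Measure X}

/-- A factor that does not involve the integrated coordinates can be pulled out. -/
theorem lmarginal_mul_of_forall_updateFinset {T : Finset V} {f g : (V → X) → ℝ≥0∞}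
    (hg : Measurable g) (h : ∀ ω η, f (Function.updateFinset ω T η) = f ω) :
    lmarginal μ T (fun σ => f σ * g σ) = fun ω => f ω * lmarginal μ T g ω := by
  funext ω
  simp only [lmarginal, h]
  exact lintegral_const_mul _ (hg.comp measurable_updateFinset)

/-- A function of the integrated coordinates alone has a constant marginal. -/
theorem lmarginal_eq_of_dependsOn {S : Finset V} {f : (V → X) → ℝ≥0∞}
    (hf : DependsOn f (S : Set V)) (ω ω' : V → X) :
    lmarginal μ S f ω = lmarginal μ S f ω' := by
  simp only [lmarginal]
  refine lintegral_congr fun η => hf fun i hi => ?_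
  simp [Function.updateFinset, Finset.mem_coe.1 hi]

end lmarginal

theorem glue_eq_updateFinset {V : Type*} [DecidableEq V] (Λ : Finset V) (η : Λ → unitInterval)
    (ω : V → unitInterval) : glue Λ η ω = Function.updateFinset ω Λ η := by
  funext x
  by_cases h : x ∈ Λ <;> simp [glue, Function.updateFinset, h]

/-! ### Boundary laws and the densities of the splitting measure -/

noncomputable section

open scoped Classical

/-- The Boltzmann factor `exp(-β U(t,u))` of a pair of neighbouring spins. -/
def PairPotential.bondWeight (U : PairPotential) (β : ℝ) (t u : unitInterval) : ℝ≥0∞ :=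
  ENNReal.ofReal (Real.exp (-β * U.energy t u))

/-- The Boltzmann factor of the configuration `σ` on the edge `e`. -/
def PairPotential.edgeWeight {V : Type*} (U : PairPotential) (β : ℝ) (σ : V → unitInterval)
    (e : Sym2 V) : ℝ≥0∞ :=
  ENNReal.ofReal (Real.exp (-β * U.edgeEnergy σ e))

/-- A translation-invariant boundary law on the Cayley tree of order `k`, in the form
`∫ exp(-β U(t,u)) b(u) ^ k du = κ b(t)`: the message which a vertex sends to its parent is
proportional to `b`, and `κ` is the constant of proportionality. -/
structure BoundaryLaw (U : PairPotential) (β : ℝ) (k : ℕ) where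
  /-- The message `b`. -/
  toFun : unitInterval → ℝ≥0∞
  measurable : Measurable toFun
  /-- The constant `κ`. -/
  eigenvalue : ℝ≥0∞
  eigenvalue_ne_zero : eigenvalue ≠ 0
  eigenvalue_ne_top : eigenvalue ≠ ∞
  law : ∀ t, ∫⁻ u, U.bondWeight β t u * toFun u ^ k = eigenvalue * toFun t
  mass_ne_zero : ∫⁻ t, toFun t ^ (k + 1) ≠ 0
  mass_ne_top : ∫⁻ t, toFun t ^ (k + 1) ≠ ∞

/-- The edges of `G` with both ends in `S`. -/
def SimpleGraph.innerEdges {V : Type*} (G : SimpleGraph V) (S : Finset V) : Finset (Sym2 V) :=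
  S.sym2.filter (· ∈ G.edgeSet)

/-- The density, with respect to the product of Lebesgue measures, of the restriction to the finite
connected set `S` of the splitting measure with boundary law `b`: every edge inside `S` contributes
its Boltzmann factor, every edge between `x ∈ S` and the complement of `S` contributes `b (σ x)`.
The prefactor is `1 / (∫ b ^ (k + 1) * κ ^ (#S - 1))`. -/
def BoundaryLaw.density {V : Type*} {U : PairPotential} {β : ℝ} {k : ℕ} (b : BoundaryLaw U β k)
    (G : SimpleGraph V) [G.LocallyFinite] (S : Finset V) (σ : V → unitInterval) : ℝ≥0∞ :=
  b.eigenvalue / (∫⁻ t, b.toFun t ^ (k + 1)) * b.eigenvalue⁻¹ ^ S.card *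
    (∏ e ∈ G.innerEdges S, U.edgeWeight β σ e) *
      ∏ x ∈ S, b.toFun (σ x) ^ (G.neighborFinset x \ S).card

section

variable {V : Type*} {U : PairPotential} {β : ℝ} {k : ℕ} {G : SimpleGraph V}

theorem SimpleGraph.mk_mem_innerEdges {S : Finset V} {x y : V} :
    s(x, y) ∈ G.innerEdges S ↔ (x ∈ S ∧ y ∈ S) ∧ G.Adj x y := by
  simp [SimpleGraph.innerEdges]

theorem PairPotential.measurable_bondWeight (t : unitInterval) :
    Measurable (U.bondWeight β t) := by
  have := U.measurable.comp (measurable_const.prodMk measurable_id : Measurable fun u => (t, u))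
  exact (Real.measurable_exp.comp (this.const_mul (-β))).ennreal_ofReal

theorem PairPotential.edgeWeight_mk (σ : V → unitInterval) (x y : V) :
    U.edgeWeight β σ s(x, y) = U.bondWeight β (σ x) (σ y) := rfl

theorem PairPotential.measurable_edgeWeight (e : Sym2 V) :
    Measurable fun σ : V → unitInterval => U.edgeWeight β σ e := by
  induction e using Sym2.ind with
  | _ x y =>
    have := U.measurable.comp ((measurable_pi_apply (X := fun _ : V => unitInterval) x).prodMk
      (measurable_pi_apply (X := fun _ : V => unitInterval) y))
    exact (Real.measurable_exp.comp (this.const_mul (-β))).ennreal_ofReal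

theorem PairPotential.edgeWeight_congr {σ τ : V → unitInterval} {e : Sym2 V}
    (h : ∀ x ∈ e, σ x = τ x) : U.edgeWeight β σ e = U.edgeWeight β τ e := by
  induction e using Sym2.ind with
  | _ x y => rw [edgeWeight_mk, edgeWeight_mk, h x (by simp), h y (by simp)]

theorem SimpleGraph.mem_of_mem_innerEdges {S : Finset V} {e : Sym2 V} (he : e ∈ G.innerEdges S)
    {x : V} (hx : x ∈ e) : x ∈ S := by
  rw [SimpleGraph.innerEdges, Finset.mem_filter, Finset.mem_sym2_iff] at he
  exact he.1 x hx

variable [G.LocallyFinite]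

theorem BoundaryLaw.measurable_density (b : BoundaryLaw U β k) (S : Finset V) :
    Measurable (b.density G S) := by
  refine Measurable.mul (Measurable.const_mul (Finset.measurable_fun_prod _ fun e _ =>
    U.measurable_edgeWeight e) _) (Finset.measurable_fun_prod _ fun x _ => ?_)
  exact (b.measurable.comp (measurable_pi_apply x)).pow_const _

theorem BoundaryLaw.dependsOn_density (b : BoundaryLaw U β k) (S : Finset V) :
    DependsOn (b.density G S) (S : Set V) := by
  intro σ τ h
  unfold BoundaryLaw.density
  congr 1
  · congr 1
    exact Finset.prod_congr rfl fun e he => U.edgeWeight_congr fun x hx =>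
      h x (SimpleGraph.mem_of_mem_innerEdges he hx)
  · exact Finset.prod_congr rfl fun x hx => by rw [h x hx]

/-- Integrating out a leaf: by the boundary law, the new edge and the message at the new vertex
contribute `κ b (σ x)`. -/
theorem BoundaryLaw.lmarginal_density_insert (b : BoundaryLaw U β k) (hG : IsCayleyTree k G)
    {S : Finset V} (hS : (G.induce (S : Set V)).Connected) {x y : V} (hx : x ∈ S) (hy : y ∉ S)
    (hxy : G.Adj x y) :
    lmarginal (fun _ => volume) {y} (b.density G (insert y S)) = b.density G S := by
  have huniq : ∀ z ∈ S, G.Adj z y → z = x := fun z hz hzy =>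
    hG.1.isAcyclic.eq_of_adj_connected hS hx hz hy hxy hzy
  have hedges : G.innerEdges (insert y S) = insert s(x, y) (G.innerEdges S) := by
    ext e
    induction e using Sym2.ind with
    | _ v w =>
      rw [Finset.mem_insert, SimpleGraph.mk_mem_innerEdges, SimpleGraph.mk_mem_innerEdges,
        Finset.mem_insert, Finset.mem_insert, Sym2.eq_iff]
      constructor
      · rintro ⟨⟨rfl | hv, rfl | hw⟩, h⟩
        · exact absurd h (G.irrefl)
        · exact Or.inl (Or.inr ⟨rfl, huniq _ hw h.symm⟩)
        · exact Or.inl (Or.inl ⟨huniq _ hv h, rfl⟩)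
        · exact Or.inr ⟨⟨hv, hw⟩, h⟩
      · rintro ((⟨rfl, rfl⟩ | ⟨rfl, rfl⟩) | ⟨⟨hv, hw⟩, h⟩)
        · exact ⟨⟨Or.inr hx, Or.inl rfl⟩, hxy⟩
        · exact ⟨⟨Or.inl rfl, Or.inr hx⟩, hxy.symm⟩
        · exact ⟨⟨Or.inr hv, Or.inr hw⟩, h⟩
  have hnot : s(x, y) ∉ G.innerEdges S := fun h => hy (SimpleGraph.mk_mem_innerEdges.1 h).1.2
  have hNy : (G.neighborFinset y \ insert y S).card = k := by
    have : G.neighborFinset y \ insert y S = (G.neighborFinset y).erase x := by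
      ext z
      simp only [Finset.mem_sdiff, SimpleGraph.mem_neighborFinset, Finset.mem_insert, not_or,
        Finset.mem_erase]
      constructor
      · rintro ⟨h1, -, h3⟩
        exact ⟨fun h => h3 (h ▸ hx), h1⟩
      · rintro ⟨h1, h2⟩
        exact ⟨h2, h2.ne', fun h => h1 (huniq z h h2.symm)⟩
    rw [this, Finset.card_erase_of_mem (by simpa using hxy.symm),
      SimpleGraph.card_neighborFinset_eq_degree, hG.2 y, Nat.add_sub_cancel]
  have hNz : ∀ z ∈ S.erase x, G.neighborFinset z \ insert y S = G.neighborFinset z \ S := by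
    intro z hz
    rw [Finset.mem_erase] at hz
    ext v
    simp only [Finset.mem_sdiff, SimpleGraph.mem_neighborFinset, Finset.mem_insert, not_or]
    constructor
    · tauto
    · rintro ⟨h1, h2⟩
      exact ⟨h1, fun h => hz.1 (huniq z hz.2 (h ▸ h1)), h2⟩
  have hNx : (G.neighborFinset x \ S).card = (G.neighborFinset x \ insert y S).card + 1 := by
    have : G.neighborFinset x \ insert y S = (G.neighborFinset x \ S).erase y := by
      ext v
      simp only [Finset.mem_sdiff, SimpleGraph.mem_neighborFinset, Finset.mem_insert, not_or,
        Finset.mem_erase]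
      tauto
    rw [this, Finset.card_erase_add_one]
    simp [hxy, hy]
  rw [lmarginal_singleton]
  funext σ
  have hne : ∀ z ∈ S, z ≠ y := fun z hz h => hy (h ▸ hz)
  -- The part of the density that does not involve the spin at the leaf.
  set A : ℝ≥0∞ := b.eigenvalue / (∫⁻ t, b.toFun t ^ (k + 1)) * b.eigenvalue⁻¹ ^ S.card *
    (∏ e ∈ G.innerEdges S, U.edgeWeight β σ e) *
      ((∏ z ∈ S.erase x, b.toFun (σ z) ^ (G.neighborFinset z \ S).card) *
        b.toFun (σ x) ^ (G.neighborFinset x \ insert y S).card) with hA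
  have key : ∀ u, b.density G (insert y S) (Function.update σ y u) =
      b.eigenvalue⁻¹ * A * (U.bondWeight β (σ x) u * b.toFun u ^ k) := by
    intro u
    have h1 : ∏ e ∈ G.innerEdges S, U.edgeWeight β (Function.update σ y u) e =
        ∏ e ∈ G.innerEdges S, U.edgeWeight β σ e :=
      Finset.prod_congr rfl fun e he => U.edgeWeight_congr fun z hz =>
        Function.update_of_ne (hne z (SimpleGraph.mem_of_mem_innerEdges he hz)) _ _
    have h2 : ∏ z ∈ S.erase x, b.toFun (Function.update σ y u z) ^
          (G.neighborFinset z \ insert y S).card =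
        ∏ z ∈ S.erase x, b.toFun (σ z) ^ (G.neighborFinset z \ S).card :=
      Finset.prod_congr rfl fun z hz => by
        rw [hNz z hz, Function.update_of_ne (hne z (Finset.mem_of_mem_erase hz))]
    rw [BoundaryLaw.density, hedges, Finset.prod_insert hnot, Finset.prod_insert hy,
      Finset.card_insert_of_notMem hy, ← Finset.prod_erase_mul S _ hx, h1, h2, hNy,
      U.edgeWeight_mk, Function.update_self, Function.update_of_ne (hne x hx), hA, pow_succ]
    ring
  simp_rw [key]
  have hm : Measurable fun u => U.bondWeight β (σ x) u * b.toFun u ^ k :=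
    (U.measurable_bondWeight _).mul (b.measurable.pow_const _)
  rw [lintegral_const_mul _ hm, b.law,
    BoundaryLaw.density, ← Finset.prod_erase_mul S _ hx, hNx, pow_succ, hA]
  calc _ = (b.eigenvalue⁻¹ * b.eigenvalue) * (b.eigenvalue / (∫⁻ t, b.toFun t ^ (k + 1)) *
            b.eigenvalue⁻¹ ^ S.card * (∏ e ∈ G.innerEdges S, U.edgeWeight β σ e) *
      ((∏ z ∈ S.erase x, b.toFun (σ z) ^ (G.neighborFinset z \ S).card) *
        (b.toFun (σ x) ^ (G.neighborFinset x \ insert y S).card * b.toFun (σ x)))) := by ring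
    _ = _ := by
      rw [ENNReal.inv_mul_cancel b.eigenvalue_ne_zero b.eigenvalue_ne_top, one_mul]

/-- The densities on finite connected sets are consistent. -/
theorem BoundaryLaw.lmarginal_density (b : BoundaryLaw U β k) (hG : IsCayleyTree k G)
    {S T : Finset V} (hS : (G.induce (S : Set V)).Connected)
    (hT : (G.induce (T : Set V)).Connected) (hST : S ⊆ T) :
    lmarginal (fun _ => volume) (T \ S) (b.density G T) = b.density G S := by
  induction h : (T \ S).card generalizing S with
  | zero =>
    have : T = S := hST.antisymm' (Finset.sdiff_eq_empty_iff_subset.1 (Finset.card_eq_zero.1 h))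
    rw [this, Finset.sdiff_self, lmarginal_empty]
  | succ n ih =>
    have hne : S ≠ T := by rintro rfl; simp at h
    have hSn : S.Nonempty := by
      obtain ⟨⟨s, hs⟩⟩ := hS.nonempty
      exact ⟨s, hs⟩
    obtain ⟨x, hx, y, hyT, hy, hxy⟩ :=
      SimpleGraph.exists_adj_of_connected_ssubset hSn hT (hST.ssubset_of_ne hne)
    have hsub : insert y S ⊆ T := Finset.insert_subset hyT hST
    have hsd : T \ S = {y} ∪ (T \ insert y S) := by
      ext z
      simp only [Finset.mem_sdiff, Finset.mem_union, Finset.mem_singleton, Finset.mem_insert]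
      by_cases hz : z = y
      · subst hz; tauto
      · tauto
    have hdisj : Disjoint {y} (T \ insert y S) := by simp
    have hcard : (T \ insert y S).card = n := by
      rw [hsd, Finset.card_union_of_disjoint hdisj, Finset.card_singleton] at h
      omega
    rw [hsd, lmarginal_union _ _ (b.measurable_density T) hdisj,
      ih (SimpleGraph.connected_induce_insert hS hx hxy) hsub hcard,
      b.lmarginal_density_insert hG hS hx hy hxy]

/-- At a single vertex the density is `b ^ (k + 1)`, normalised. -/
theorem BoundaryLaw.density_singleton (b : BoundaryLaw U β k) (hG : IsCayleyTree k G) (x : V)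
    (σ : V → unitInterval) :
    b.density G {x} σ = (∫⁻ t, b.toFun t ^ (k + 1))⁻¹ * b.toFun (σ x) ^ (k + 1) := by
  have h1 : G.innerEdges {x} = ∅ := by
    refine Finset.eq_empty_of_forall_notMem fun e => ?_
    induction e using Sym2.ind with
    | _ v w =>
      rw [SimpleGraph.mk_mem_innerEdges, Finset.mem_singleton, Finset.mem_singleton]
      rintro ⟨⟨rfl, rfl⟩, h⟩
      exact G.irrefl h
  have h2 : (G.neighborFinset x \ {x}).card = k + 1 := by
    rw [Finset.sdiff_singleton_eq_erase, Finset.erase_eq_of_notMem (by simp),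
      SimpleGraph.card_neighborFinset_eq_degree, hG.2 x]
  rw [BoundaryLaw.density, h1, Finset.prod_empty, Finset.prod_singleton, h2, Finset.card_singleton,
    pow_one, mul_one, ENNReal.div_eq_inv_mul, mul_assoc _ b.eigenvalue,
    ENNReal.mul_inv_cancel b.eigenvalue_ne_zero b.eigenvalue_ne_top, mul_one]

theorem BoundaryLaw.lmarginal_density_self (b : BoundaryLaw U β k) (hG : IsCayleyTree k G)
    {S : Finset V} (hS : (G.induce (S : Set V)).Connected) (ω : V → unitInterval) :
    lmarginal (fun _ => volume) S (b.density G S) ω = 1 := by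
  obtain ⟨⟨x, hx⟩⟩ := hS.nonempty
  have hx1 : (G.induce (({x} : Finset V) : Set V)).Connected := by
    rw [Finset.coe_singleton]
    exact SimpleGraph.Connected.of_subsingleton
  have hsub : {x} ⊆ S := Finset.singleton_subset_iff.2 hx
  rw [← Finset.union_sdiff_of_subset hsub, lmarginal_union _ _ (b.measurable_density _)
    Finset.disjoint_sdiff, Finset.union_sdiff_of_subset hsub, b.lmarginal_density hG hx1 hS hsub,
    lmarginal_singleton]
  simp_rw [b.density_singleton hG, Function.update_self]
  rw [lintegral_const_mul _ (b.measurable.pow_const _),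
    ENNReal.inv_mul_cancel b.mass_ne_zero b.mass_ne_top]

/-- The expectation of a function of the spins in `S` may be computed in any larger connected set. -/
theorem BoundaryLaw.lmarginal_mul_density (b : BoundaryLaw U β k) (hG : IsCayleyTree k G)
    {S T : Finset V} (hS : (G.induce (S : Set V)).Connected)
    (hT : (G.induce (T : Set V)).Connected) (hST : S ⊆ T) {f : (V → unitInterval) → ℝ≥0∞}
    (hf : Measurable f) (hfS : DependsOn f (S : Set V)) :
    lmarginal (fun _ => volume) T (fun σ => f σ * b.density G T σ) =
      lmarginal (fun _ => volume) S (fun σ => f σ * b.density G S σ) := by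
  have hm := hf.mul (b.measurable_density (G := G) T)
  rw [← Finset.union_sdiff_of_subset hST, lmarginal_union _ _ (by
    rwa [Finset.union_sdiff_of_subset hST]) Finset.disjoint_sdiff,
    Finset.union_sdiff_of_subset hST, lmarginal_mul_of_forall_updateFinset
      (b.measurable_density _)
      (fun ω η => dependsOn_comp_updateFinset hfS Finset.disjoint_sdiff ω η),
    b.lmarginal_density hG hS hT hST]

end

end

/-! ### Measures with prescribed marginals on a countable power of a compact space -/

/-- Kolmogorov extension for a compact space `X` and a cofinal family `C` of finite index sets. The
limit is a cluster point of the measures `P S`, which exists since the space of probability measures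
on a compact space is compact. -/
theorem exists_probabilityMeasure_map_restrict_eq {V X : Type*} [Countable V] [MetricSpace X]
    [CompactSpace X] [SecondCountableTopology X] [MeasurableSpace X] [BorelSpace X]
    (C : Set (Finset V)) (hC : ∀ S, ∃ T ∈ C, S ⊆ T) (P : Finset V → ProbabilityMeasure (V → X))
    (hP : ∀ S ∈ C, ∀ T ∈ C, S ⊆ T →
      (P T : Measure (V → X)).map S.restrict = (P S : Measure (V → X)).map S.restrict) :
    ∃ μ : ProbabilityMeasure (V → X), ∀ S ∈ C,
      (μ : Measure (V → X)).map S.restrict = (P S : Measure (V → X)).map S.restrict := by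
  classical
  choose h hhC hh using hC
  let F : Ultrafilter (Finset V) := Ultrafilter.of Filter.atTop
  obtain ⟨μ, -, hμ⟩ := isCompact_univ.ultrafilter_le_nhds (F.map fun T => P (h T)) (by simp)
  have hlim : Filter.Tendsto (fun T => P (h T)) F (nhds μ) := hμ
  refine ⟨μ, fun S hS => ?_⟩
  have hcont : Continuous (S.restrict : (V → X) → (S → X)) :=
    continuous_pi fun i => continuous_apply _
  have h1 := ProbabilityMeasure.tendsto_map_of_tendsto_of_continuous _ _ hlim hcont
  have h2 : ∀ᶠ T in (F : Filter (Finset V)),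
      (P (h T)).map hcont.aemeasurable = (P S).map hcont.aemeasurable := by
    refine Ultrafilter.of_le _ ((Filter.eventually_ge_atTop S).mono fun T hT => ?_)
    refine Subtype.ext ?_
    simpa using hP S hS (h T) (hhC T) (hT.trans (hh T))
  have h3 := tendsto_nhds_unique h1 (tendsto_const_nhds.congr' (h2.mono fun T hT => hT.symm))
  simpa using congrArg (fun ν : ProbabilityMeasure (S → X) => (ν : Measure (S → X))) h3

/-! ### The splitting measure: existence, uniqueness, invariance -/

noncomputable section

open scoped Classical

/-- `μ` is the splitting measure of the boundary law `b`: its restriction to every finite connected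
set `S` has the density `b.density G S` with respect to the product of Lebesgue measures. This is
expressed through the integrals of the functions of the spins in `S`; the configuration `ω` off `S`
is immaterial. -/
def BoundaryLaw.IsSplittingMeasure {V : Type*} {U : PairPotential} {β : ℝ} {k : ℕ}
    (b : BoundaryLaw U β k) (G : SimpleGraph V) [G.LocallyFinite]
    (μ : Measure (V → unitInterval)) : Prop :=
  ∀ S : Finset V, (G.induce (S : Set V)).Connected → ∀ f : (V → unitInterval) → ℝ≥0∞,
    Measurable f → DependsOn f (S : Set V) → ∀ ω,
      ∫⁻ σ, f σ ∂μ = lmarginal (fun _ => volume) S (fun σ => f σ * b.density G S σ) ω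

/-- Every finite set of vertices of a connected graph lies in a finite connected set. -/
theorem SimpleGraph.Connected.exists_finset_connected_superset {V : Type*} {G : SimpleGraph V}
    (hG : G.Connected) (S : Finset V) :
    ∃ T : Finset V, S ⊆ T ∧ (G.induce (T : Set V)).Connected := by
  obtain ⟨r⟩ := hG.nonempty
  obtain ⟨T, hT, hTc⟩ := G.extend_finset_to_connected hG.preconnected (Finset.insert_nonempty r S)
  exact ⟨T, (Finset.subset_insert r S).trans hT, hTc⟩

theorem dependsOn_comp_restrict {V X β : Type*} (S : Finset V) (g : (S → X) → β) :
    DependsOn (fun σ : V → X => g (S.restrict σ)) (S : Set V) := fun σ τ h => by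
  have : S.restrict σ = S.restrict τ := funext fun i => h i i.2
  simp only [this]

section

variable {V : Type*} {U : PairPotential} {β : ℝ} {k : ℕ} {G : SimpleGraph V} [G.LocallyFinite]

/-- The finite-dimensional distribution on `S`, realised on all configurations by giving the spins
off `S` the value `0`. -/
def BoundaryLaw.marginalMeasure (b : BoundaryLaw U β k) (G : SimpleGraph V) [G.LocallyFinite]
    (S : Finset V) : Measure (V → unitInterval) :=
  ((Measure.pi fun _ : S => volume).map (Function.updateFinset (fun _ => 0) S)).withDensity
    (b.density G S)

theorem BoundaryLaw.lintegral_marginalMeasure (b : BoundaryLaw U β k) (S : Finset V)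
    {f : (V → unitInterval) → ℝ≥0∞} (hf : Measurable f) :
    ∫⁻ σ, f σ ∂(b.marginalMeasure G S) =
      lmarginal (fun _ => volume) S (fun σ => f σ * b.density G S σ) fun _ => 0 := by
  rw [marginalMeasure, lintegral_withDensity_eq_lintegral_mul _ (b.measurable_density S) hf,
    lintegral_map ((b.measurable_density S).mul hf) measurable_updateFinset, lmarginal]
  simp only [Pi.mul_apply, mul_comm]

theorem BoundaryLaw.isProbabilityMeasure_marginalMeasure (b : BoundaryLaw U β k)
    (hG : IsCayleyTree k G) {S : Finset V} (hS : (G.induce (S : Set V)).Connected) :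
    IsProbabilityMeasure (b.marginalMeasure G S) := by
  refine ⟨?_⟩
  rw [← lintegral_one, b.lintegral_marginalMeasure S measurable_const]
  simpa only [one_mul] using b.lmarginal_density_self hG hS _

theorem BoundaryLaw.exists_isSplittingMeasure (b : BoundaryLaw U β k) (hG : IsCayleyTree k G) :
    ∃ μ : Measure (V → unitInterval), IsProbabilityMeasure μ ∧ b.IsSplittingMeasure G μ := by
  have := hG.1.connected.countable_of_locallyFinite
  let P : Finset V → ProbabilityMeasure (V → unitInterval) := fun S =>
    if h : (G.induce (S : Set V)).Connected then
      ⟨b.marginalMeasure G S, b.isProbabilityMeasure_marginalMeasure hG h⟩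
    else ⟨Measure.dirac fun _ => 0, inferInstance⟩
  have hP : ∀ S : Finset V, (G.induce (S : Set V)).Connected →
      (P S : Measure (V → unitInterval)) = b.marginalMeasure G S := fun S h => by
    exact congrArg (fun ν : ProbabilityMeasure (V → unitInterval) =>
      (ν : Measure (V → unitInterval))) (dif_pos h)
  obtain ⟨μ, hμ⟩ := exists_probabilityMeasure_map_restrict_eq
    {S : Finset V | (G.induce (S : Set V)).Connected}
    (fun S => by
      obtain ⟨T, h1, h2⟩ := hG.1.connected.exists_finset_connected_superset S
      exact ⟨T, h2, h1⟩) P (by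
      intro S hS T hT hST
      rw [hP S hS, hP T hT]
      ext A hA
      have hm : Measurable fun σ : V → unitInterval => A.indicator (1 : (S → unitInterval) → ℝ≥0∞)
          (S.restrict σ) :=
        (measurable_one.indicator hA).comp (Finset.measurable_restrict S)
      rw [← lintegral_indicator_one hA, ← lintegral_indicator_one hA,
        lintegral_map (measurable_one.indicator hA) (Finset.measurable_restrict S),
        lintegral_map (measurable_one.indicator hA) (Finset.measurable_restrict S),
        b.lintegral_marginalMeasure T hm, b.lintegral_marginalMeasure S hm,
        b.lmarginal_mul_density hG hS hT hST hm (dependsOn_comp_restrict S _)])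
  refine ⟨μ, inferInstance, fun S hS f hf hfS ω => ?_⟩
  have hfg : ∀ σ, f σ = f (Function.updateFinset (fun _ => 0) S (S.restrict σ)) := fun σ =>
    hfS fun i hi => by simp [Function.updateFinset, Finset.mem_coe.1 hi]
  have hg : Measurable fun η : S → unitInterval => f (Function.updateFinset (fun _ => 0) S η) :=
    hf.comp measurable_updateFinset
  have hmap := hμ S hS
  rw [hP S hS] at hmap
  calc ∫⁻ σ, f σ ∂(μ : Measure (V → unitInterval))
      = ∫⁻ η, f (Function.updateFinset (fun _ => 0) S η)
          ∂((μ : Measure (V → unitInterval)).map S.restrict) := by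
        rw [lintegral_map hg (Finset.measurable_restrict S)]
        exact lintegral_congr hfg
    _ = ∫⁻ σ, f σ ∂(b.marginalMeasure G S) := by
        rw [hmap, lintegral_map hg (Finset.measurable_restrict S)]
        exact (lintegral_congr hfg).symm
    _ = lmarginal (fun _ => volume) S (fun σ => f σ * b.density G S σ) ω := by
        rw [b.lintegral_marginalMeasure S hf]
        refine lmarginal_eq_of_dependsOn (fun σ τ h => ?_) _ _
        simp only [hfS h, b.dependsOn_density S h]

/-- Two probability measures that agree on the functions of finitely many spins are equal. -/
theorem ext_of_forall_lintegral_dependsOn {X : Type*} [MeasurableSpace X] {G : SimpleGraph V}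
    (hG : G.Connected) {μ ν : Measure (V → X)} [IsProbabilityMeasure μ]
    [IsProbabilityMeasure ν]
    (h : ∀ S : Finset V, (G.induce (S : Set V)).Connected → ∀ f : (V → X) → ℝ≥0∞,
      Measurable f → DependsOn f (S : Set V) → ∫⁻ σ, f σ ∂μ = ∫⁻ σ, f σ ∂ν) : μ = ν := by
  refine ext_of_generate_finite (measurableCylinders fun _ : V => X)
    generateFrom_measurableCylinders.symm isPiSystem_measurableCylinders (fun A hA => ?_)
    (by simp)
  obtain ⟨S, B, hB, rfl⟩ := (mem_measurableCylinders _).1 hA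
  obtain ⟨T, hST, hT⟩ := hG.exists_finset_connected_superset S
  have hm : MeasurableSet (cylinder S B) := MeasurableSet.cylinder (α := fun _ => X) S hB
  rw [← lintegral_indicator_one hm, ← lintegral_indicator_one hm]
  refine h T hT _ (measurable_one.indicator hm) fun σ τ hστ => ?_
  have : S.restrict σ = S.restrict τ := funext fun i => hστ i (hST i.2)
  simp only [Set.indicator, mem_cylinder, this, Pi.one_apply]

theorem BoundaryLaw.IsSplittingMeasure.unique {b : BoundaryLaw U β k} (hG : G.Connected)
    {μ ν : Measure (V → unitInterval)} [IsProbabilityMeasure μ] [IsProbabilityMeasure ν]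
    (hμ : b.IsSplittingMeasure G μ) (hν : b.IsSplittingMeasure G ν) : μ = ν :=
  ext_of_forall_lintegral_dependsOn hG fun S hS f hf hfS => by
    rw [hμ S hS f hf hfS fun _ => 0, hν S hS f hf hfS fun _ => 0]

theorem BoundaryLaw.density_image (b : BoundaryLaw U β k) (φ : G ≃g G) (S : Finset V)
    (σ : V → unitInterval) :
    b.density G (S.image φ) σ = b.density G S (fun x => σ (φ x)) := by
  have hedges : G.innerEdges (S.image φ) = (G.innerEdges S).image (Sym2.map φ) := by
    ext e
    induction e using Sym2.ind with
    | _ v w =>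
      obtain ⟨v, rfl⟩ := φ.surjective v
      obtain ⟨w, rfl⟩ := φ.surjective w
      rw [← Sym2.map_mk, Function.Injective.mem_finset_image (Sym2.map.injective φ.injective),
        Sym2.map_mk, SimpleGraph.mk_mem_innerEdges, SimpleGraph.mk_mem_innerEdges,
        φ.injective.mem_finset_image, φ.injective.mem_finset_image, φ.map_adj_iff]
  have hN : ∀ x, G.neighborFinset (φ x) \ S.image φ = (G.neighborFinset x \ S).image φ := by
    intro x
    ext v
    obtain ⟨v, rfl⟩ := φ.surjective v
    rw [φ.injective.mem_finset_image, Finset.mem_sdiff, Finset.mem_sdiff,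
      φ.injective.mem_finset_image, SimpleGraph.mem_neighborFinset,
      SimpleGraph.mem_neighborFinset, φ.map_adj_iff]
  unfold BoundaryLaw.density
  rw [hedges, Finset.prod_image (Sym2.map.injective φ.injective).injOn,
    Finset.prod_image φ.injective.injOn, Finset.card_image_of_injective S φ.injective]
  congr 1
  · congr 1
    refine Finset.prod_congr rfl fun e _ => ?_
    induction e using Sym2.ind with
    | _ v w => rfl
  · refine Finset.prod_congr rfl fun x _ => ?_
    rw [hN, Finset.card_image_of_injective _ φ.injective]

theorem BoundaryLaw.IsSplittingMeasure.isTranslationInvariant {b : BoundaryLaw U β k}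
    (hG : G.Connected) {μ : Measure (V → unitInterval)} [IsProbabilityMeasure μ]
    (hμ : b.IsSplittingMeasure G μ) : IsTranslationInvariant G μ := by
  intro φ
  have hφ : Measurable fun (σ : V → unitInterval) x => σ (φ x) :=
    measurable_pi_lambda _ fun x => measurable_pi_apply _
  have := Measure.isProbabilityMeasure_map (μ := μ) hφ.aemeasurable
  refine BoundaryLaw.IsSplittingMeasure.unique (b := b) hG (fun S hS f hf hfS ω => ?_) hμ
  have hS' : (G.induce ((S.image φ : Finset V) : Set V)).Connected := by
    rw [Finset.coe_image]
    exact (SimpleGraph.Iso.connected_iff (φ.induce φ.injective.injOn.bijOn_image)).1 hS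
  obtain ⟨ω, rfl⟩ : ∃ ω' : V → unitInterval, ω = fun x => ω' (φ x) :=
    ⟨fun x => ω (φ.symm x), by simp⟩
  rw [lintegral_map hf hφ]
  refine (hμ _ hS' _ (hf.comp hφ) (fun σ τ h => hfS fun i hi =>
    h (φ i) (by simpa using hi)) ω).trans ?_
  simp_rw [b.density_image φ S]
  exact lmarginal_image (X := fun _ : V => unitInterval)
    (μ := fun _ : V => (volume : Measure unitInterval)) φ.injective S
      (hf.mul (b.measurable_density (G := G) S)) ω

end

end

/-! ### The DLR equations -/

noncomputable section

open scoped Classical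

/-- The Boltzmann weight `exp(-β H_Λ(σ))` as a function of the whole configuration. -/
def PairPotential.boltzmann {V : Type*} (U : PairPotential) (G : SimpleGraph V) [G.LocallyFinite]
    (β : ℝ) (Λ : Finset V) (σ : V → unitInterval) : ℝ≥0∞ :=
  ENNReal.ofReal (Real.exp (-β * U.hamiltonian G Λ σ))

section

variable {V : Type*} {U : PairPotential} {β : ℝ} {k : ℕ} {G : SimpleGraph V} [G.LocallyFinite]

theorem PairPotential.boltzmann_eq_prod (Λ : Finset V) (σ : V → unitInterval) :
    U.boltzmann G β Λ σ =
      ∏ e ∈ Λ.biUnion (fun x => G.incidenceFinset x), U.edgeWeight β σ e := by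
  unfold PairPotential.boltzmann PairPotential.hamiltonian PairPotential.edgeWeight
  rw [Finset.mul_sum, Real.exp_sum, ENNReal.ofReal_prod_of_nonneg fun _ _ => (Real.exp_pos _).le]

theorem PairPotential.measurable_boltzmann (Λ : Finset V) : Measurable (U.boltzmann G β Λ) := by
  rw [funext (U.boltzmann_eq_prod (G := G) (β := β) Λ)]
  exact Finset.measurable_fun_prod _ fun e _ => U.measurable_edgeWeight e

theorem PairPotential.exists_boltzmann_bounds (U : PairPotential) (G : SimpleGraph V)
    [G.LocallyFinite] (β : ℝ) (Λ : Finset V) :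
    ∃ c C : ℝ≥0∞, c ≠ 0 ∧ C ≠ ∞ ∧ ∀ σ, c ≤ U.boltzmann G β Λ σ ∧ U.boltzmann G β Λ σ ≤ C := by
  obtain ⟨B, hB⟩ := U.bounded
  have hH : ∀ σ : V → unitInterval, |U.hamiltonian G Λ σ| ≤
      (Λ.biUnion (fun x => G.incidenceFinset x)).card * B := by
    intro σ
    refine (Finset.abs_sum_le_sum_abs _ _).trans ?_
    rw [← nsmul_eq_mul]
    refine Finset.sum_le_card_nsmul _ _ _ fun e _ => ?_
    induction e using Sym2.ind with
    | _ x y => exact hB (σ x) (σ y)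
  set M := |β| * ((Λ.biUnion (fun x => G.incidenceFinset x)).card * B) with hM
  have hM' : ∀ σ : V → unitInterval, |-β * U.hamiltonian G Λ σ| ≤ M := fun σ => by
    rw [abs_mul, abs_neg]
    exact mul_le_mul_of_nonneg_left (hH σ) (abs_nonneg _)
  refine ⟨ENNReal.ofReal (Real.exp (-M)), ENNReal.ofReal (Real.exp M), ?_, ENNReal.ofReal_ne_top,
    fun σ => ⟨?_, ?_⟩⟩
  · exact (ENNReal.ofReal_pos.2 (Real.exp_pos _)).ne'
  · exact ENNReal.ofReal_le_ofReal (Real.exp_le_exp.2 (abs_le.1 (hM' σ)).1)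
  · exact ENNReal.ofReal_le_ofReal (Real.exp_le_exp.2 (abs_le.1 (hM' σ)).2)

theorem PairPotential.lmarginal_boltzmann_ne (U : PairPotential) (G : SimpleGraph V)
    [G.LocallyFinite] (β : ℝ) (Λ : Finset V) (ω : V → unitInterval) :
    lmarginal (fun _ => volume) Λ (U.boltzmann G β Λ) ω ≠ 0 ∧
      lmarginal (fun _ => volume) Λ (U.boltzmann G β Λ) ω ≠ ∞ := by
  obtain ⟨c, C, hc, hC, h⟩ := U.exists_boltzmann_bounds G β Λ
  constructor
  · have : c ≤ lmarginal (fun _ => volume) Λ (U.boltzmann G β Λ) ω := by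
      calc c = ∫⁻ _ : Λ → unitInterval, c ∂(Measure.pi fun _ => volume) := by simp
        _ ≤ _ := lintegral_mono fun η => (h _).1
    exact (hc.bot_lt.trans_le this).ne'
  · have : lmarginal (fun _ => volume) Λ (U.boltzmann G β Λ) ω ≤ C := by
      calc lmarginal (fun _ => volume) Λ (U.boltzmann G β Λ) ω
          ≤ ∫⁻ _ : Λ → unitInterval, C ∂(Measure.pi fun _ => volume) :=
            lintegral_mono fun η => (h _).2
        _ = C := by simp
    exact (this.trans_lt hC.lt_top).ne

theorem PairPotential.partitionFunction_eq (Λ : Finset V) (ω : V → unitInterval) :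
    U.partitionFunction G β Λ ω = lmarginal (fun _ => volume) Λ (U.boltzmann G β Λ) ω := by
  simp only [partitionFunction, weight, boltzmann, aprioriMeasure, lmarginal,
    glue_eq_updateFinset]

theorem PairPotential.kernel_apply (Λ : Finset V) (ω : V → unitInterval)
    {A : Set (V → unitInterval)} (hA : MeasurableSet A) :
    U.kernel G β Λ ω A = (lmarginal (fun _ => volume) Λ (U.boltzmann G β Λ) ω)⁻¹ *
      lmarginal (fun _ => volume) Λ (fun σ => A.indicator 1 σ * U.boltzmann G β Λ σ) ω := by
  have hW : Measurable fun η => U.weight G β Λ ω η :=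
    (U.measurable_boltzmann (G := G) (β := β) Λ).comp (measurable_glue Λ ω)
  have hF : Measurable fun η => A.indicator (1 : (V → unitInterval) → ℝ≥0∞) (glue Λ η ω) :=
    (measurable_one.indicator hA).comp (measurable_glue Λ ω)
  rw [kernel, ← lintegral_indicator_one hA,
    lintegral_map (measurable_one.indicator hA) (measurable_glue Λ ω),
    lintegral_withDensity_eq_lintegral_mul _ (hW.const_mul _) hF, partitionFunction_eq]
  have hAW : Measurable fun η : Λ → unitInterval =>
      A.indicator 1 (Function.updateFinset ω Λ η) *
        U.boltzmann G β Λ (Function.updateFinset ω Λ η) :=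
    ((measurable_one.indicator hA).mul (U.measurable_boltzmann Λ)).comp measurable_updateFinset
  rw [lmarginal.eq_def _ _ fun σ => A.indicator 1 σ * U.boltzmann G β Λ σ,
    ← lintegral_const_mul _ hAW]
  refine lintegral_congr fun η => ?_
  simp only [Pi.mul_apply, ← glue_eq_updateFinset, weight, boltzmann]
  ring

theorem PairPotential.measurable_kernel (U : PairPotential) (G : SimpleGraph V)
    [G.LocallyFinite] (β : ℝ) (Λ : Finset V) : Measurable (U.kernel G β Λ) := by
  refine Measure.measurable_of_measurable_coe _ fun A hA => ?_
  simp_rw [U.kernel_apply Λ _ hA]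
  exact ((U.measurable_boltzmann Λ).lmarginal _).inv.mul
    (((measurable_one.indicator hA).mul (U.measurable_boltzmann Λ)).lmarginal _)

theorem PairPotential.kernel_univ (Λ : Finset V) (ω : V → unitInterval) :
    U.kernel G β Λ ω Set.univ = 1 := by
  rw [U.kernel_apply Λ ω MeasurableSet.univ]
  simp only [Set.indicator_univ, Pi.one_apply, one_mul]
  obtain ⟨h0, h1⟩ := U.lmarginal_boltzmann_ne G β Λ ω
  exact ENNReal.inv_mul_cancel h0 h1

/-- Let `T` contain `Λ` and its neighbours. Then the density on `T` is the Boltzmann weight of `Λ`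
times a function of the spins off `Λ`. -/
theorem BoundaryLaw.exists_density_eq_mul_boltzmann (b : BoundaryLaw U β k) {Λ T : Finset V}
    (hΛT : ∀ x ∈ Λ, insert x (G.neighborFinset x) ⊆ T) :
    ∃ g : (V → unitInterval) → ℝ≥0∞, Measurable g ∧
      (∀ ω η, g (Function.updateFinset ω Λ η) = g ω) ∧
        ∀ σ, b.density G T σ = g σ * U.boltzmann G β Λ σ := by
  have hsub : Λ ⊆ T := fun x hx => hΛT x hx (Finset.mem_insert_self _ _)
  have hE : Λ.biUnion (fun x => G.incidenceFinset x) ⊆ G.innerEdges T := by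
    intro e he
    obtain ⟨x, hx, he⟩ := Finset.mem_biUnion.1 he
    rw [SimpleGraph.mem_incidenceFinset] at he
    induction e using Sym2.ind with
    | _ v w =>
      obtain ⟨h1, h2⟩ := he
      rw [SimpleGraph.mem_edgeSet] at h1
      rw [SimpleGraph.mk_mem_innerEdges]
      refine ⟨?_, h1⟩
      rcases Sym2.mem_iff.1 h2 with rfl | rfl
      · exact ⟨hsub hx, hΛT _ hx (by simp [h1])⟩
      · exact ⟨hΛT _ hx (by simp [h1.symm]), hsub hx⟩
  set c := b.eigenvalue / (∫⁻ t, b.toFun t ^ (k + 1)) * b.eigenvalue⁻¹ ^ T.card with hc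
  refine ⟨fun σ => c *
    (∏ e ∈ G.innerEdges T \ Λ.biUnion (fun x => G.incidenceFinset x), U.edgeWeight β σ e) *
      ∏ x ∈ T \ Λ, b.toFun (σ x) ^ (G.neighborFinset x \ T).card, ?_, fun ω η => ?_, fun σ => ?_⟩
  · refine Measurable.mul (Measurable.const_mul (Finset.measurable_fun_prod _ fun e _ =>
      U.measurable_edgeWeight e) _) (Finset.measurable_fun_prod _ fun x _ => ?_)
    exact (b.measurable.comp (measurable_pi_apply x)).pow_const _
  · have hup : ∀ x ∉ Λ, Function.updateFinset ω Λ η x = ω x := fun x hx => by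
      simp [Function.updateFinset, hx]
    beta_reduce
    congr 1
    · congr 1
      refine Finset.prod_congr rfl fun e he => U.edgeWeight_congr fun x hxe => hup x fun hx => ?_
      rw [Finset.mem_sdiff] at he
      refine he.2 (Finset.mem_biUnion.2 ⟨x, hx, ?_⟩)
      rw [SimpleGraph.mem_incidenceFinset]
      exact ⟨(Finset.mem_filter.1 he.1).2, hxe⟩
    · refine Finset.prod_congr rfl fun x hx => ?_
      rw [hup x (Finset.mem_sdiff.1 hx).2]
  · have h1 : ∏ x ∈ Λ, b.toFun (σ x) ^ (G.neighborFinset x \ T).card = 1 :=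
      Finset.prod_eq_one fun x hx => by
        rw [Finset.sdiff_eq_empty_iff_subset.2 ((Finset.subset_insert _ _).trans (hΛT x hx)),
          Finset.card_empty, pow_zero]
    rw [BoundaryLaw.density, ← Finset.prod_sdiff hE, ← Finset.prod_sdiff hsub, h1, mul_one,
      U.boltzmann_eq_prod, hc]
    ring

/-- The splitting measure satisfies the DLR equation for `Λ`: on a connected set `T` containing `Λ`
and its neighbours, its density is the Boltzmann weight of `Λ` times a function of the spins off
`Λ`, so integrating the spins in `Λ` with and without the kernel gives the same result. -/
theorem BoundaryLaw.IsSplittingMeasure.isGibbsMeasure {b : BoundaryLaw U β k}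
    (hG : G.Connected) {μ : Measure (V → unitInterval)} [IsProbabilityMeasure μ]
    (hμ : b.IsSplittingMeasure G μ) : U.IsGibbsMeasure G β μ := by
  refine ⟨inferInstance, fun Λ A hA => ?_⟩
  have hK := U.measurable_kernel G β Λ
  suffices h : μ = μ.bind (U.kernel G β Λ) by
    conv_lhs => rw [h]
    exact Measure.bind_apply hA hK.aemeasurable
  have hprob : (μ.bind (U.kernel G β Λ)) Set.univ = 1 := by
    rw [Measure.bind_apply MeasurableSet.univ hK.aemeasurable]
    simp [U.kernel_univ]
  refine ext_of_generate_finite (measurableCylinders fun _ : V => unitInterval)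
    generateFrom_measurableCylinders.symm isPiSystem_measurableCylinders (fun A hA => ?_)
    (by rw [hprob, measure_univ])
  obtain ⟨S, B, hB, rfl⟩ := (mem_measurableCylinders _).1 hA
  have hm : MeasurableSet (cylinder S B) := MeasurableSet.cylinder (α := fun _ => unitInterval) S hB
  obtain ⟨T, hST, hT⟩ := hG.exists_finset_connected_superset
    (S ∪ Λ.biUnion fun x => insert x (G.neighborFinset x))
  have hΛT : ∀ x ∈ Λ, insert x (G.neighborFinset x) ⊆ T := fun x hx =>
    (Finset.subset_biUnion_of_mem (fun x => insert x (G.neighborFinset x)) hx).trans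
      (Finset.subset_union_right.trans hST)
  have hsub : Λ ⊆ T := fun x hx => hΛT x hx (Finset.mem_insert_self _ _)
  rw [Measure.bind_apply hm hK.aemeasurable, ← lintegral_indicator_one hm]
  simp_rw [U.kernel_apply Λ _ hm]
  set f : (V → unitInterval) → ℝ≥0∞ := (cylinder S B).indicator 1 with hf
  have hfm : Measurable f := measurable_one.indicator hm
  have hfT : DependsOn f (T : Set V) := fun σ τ hστ => by
    have : S.restrict σ = S.restrict τ :=
      funext fun i => hστ i (hST (Finset.mem_union_left _ i.2))
    simp only [hf, Set.indicator, mem_cylinder, this, Pi.one_apply]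
  set W := U.boltzmann G β Λ with hW
  have hWm : Measurable W := U.measurable_boltzmann Λ
  have hWT : DependsOn W (T : Set V) := fun σ τ hστ => by
    rw [hW, U.boltzmann_eq_prod, U.boltzmann_eq_prod]
    refine Finset.prod_congr rfl fun e he => U.edgeWeight_congr fun x hx => ?_
    obtain ⟨y, hy, he⟩ := Finset.mem_biUnion.1 he
    rw [SimpleGraph.mem_incidenceFinset] at he
    refine hστ x (hΛT y hy ?_)
    rw [Finset.mem_insert, SimpleGraph.mem_neighborFinset]
    by_cases hxy : x = y
    · exact Or.inl hxy
    · have : e = s(y, x) := ((Sym2.mem_and_mem_iff (Ne.symm hxy)).1 ⟨he.2, hx⟩)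
      right
      rw [← SimpleGraph.mem_edgeSet, ← this]
      exact he.1
  have hmargT : ∀ F : (V → unitInterval) → ℝ≥0∞, DependsOn F (T : Set V) →
      DependsOn (lmarginal (fun _ => volume) Λ F) (T : Set V) := fun F hF σ τ hστ => by
    simp only [lmarginal]
    refine lintegral_congr fun η => hF fun i hi => ?_
    by_cases h : i ∈ Λ <;> simp [Function.updateFinset, h, hστ i hi]
  set Q : (V → unitInterval) → ℝ≥0∞ := fun ω => (lmarginal (fun _ => volume) Λ W ω)⁻¹ *
    lmarginal (fun _ => volume) Λ (fun σ => f σ * W σ) ω with hQ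
  have hQm : Measurable Q := (hWm.lmarginal _).inv.mul ((hfm.mul hWm).lmarginal _)
  have hQT : DependsOn Q (T : Set V) := fun σ τ h => by
    simp only [hQ]
    rw [hmargT W hWT h, hmargT (fun σ => f σ * W σ)
      (fun σ τ h => by simp only [hfT h, hWT h]) h]
  obtain ⟨g, hgm, hgΛ, hg⟩ := b.exists_density_eq_mul_boltzmann (G := G) hΛT
  have hQΛ : ∀ ω η, Q (Function.updateFinset ω Λ η) = Q ω := fun ω η => by
    have h : ∀ i ∉ Λ, Function.updateFinset ω Λ η i = ω i := fun i hi => by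
      simp [Function.updateFinset, hi]
    simp only [hQ]
    rw [lmarginal_congr _ _ h, lmarginal_congr _ _ h]
  rw [hμ T hT f hfm hfT fun _ => 0, hμ T hT Q hQm hQT fun _ => 0]
  simp_rw [hg]
  have hcore : lmarginal (fun _ => volume) Λ (fun σ => f σ * (g σ * W σ)) =
      lmarginal (fun _ => volume) Λ (fun σ => Q σ * (g σ * W σ)) := by
    have e1 : (fun σ => f σ * (g σ * W σ)) = fun σ => g σ * (f σ * W σ) := by
      funext σ; ring
    have e2 : (fun σ => Q σ * (g σ * W σ)) = fun σ => (g σ * Q σ) * W σ := by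
      funext σ; ring
    have hfW : Measurable fun σ => f σ * W σ := hfm.mul hWm
    rw [e1, e2, lmarginal_mul_of_forall_updateFinset hfW hgΛ,
      lmarginal_mul_of_forall_updateFinset (f := fun σ => g σ * Q σ) hWm
        fun ω η => by rw [hgΛ, hQΛ]]
    funext ω
    obtain ⟨h0, h1⟩ := U.lmarginal_boltzmann_ne G β Λ ω
    rw [mul_assoc, hQ]
    beta_reduce
    rw [mul_comm (_)⁻¹, mul_assoc, ENNReal.inv_mul_cancel h0 h1, mul_one]
  exact congrFun
    (lmarginal_eq_of_subset hsub (hfm.mul (hgm.mul hWm)) (hQm.mul (hgm.mul hWm)) hcore) _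

end

end

/-! ### Moments of the seventh root -/

noncomputable section

theorem seventhRoot_mul (x y : ℝ) : seventhRoot (x * y) = seventhRoot x * seventhRoot y := by
  have h : Function.Injective fun a : ℝ => a ^ 7 := (Odd.strictMono_pow (by decide)).injective
  refine h ?_
  simp only [mul_pow, seventhRoot_pow]

theorem seventhRoot_neg (x : ℝ) : seventhRoot (-x) = -seventhRoot x := by
  simp [seventhRoot, Real.sign_neg]

theorem sq_seventhRoot (x : ℝ) : seventhRoot x ^ 2 = |x| ^ (2 / 7 : ℝ) := by
  have h : (|x| ^ (1 / 7 : ℝ)) ^ 2 = |x| ^ (2 / 7 : ℝ) := by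
    rw [← Real.rpow_natCast, ← Real.rpow_mul (abs_nonneg x)]
    norm_num
  rw [seventhRoot, mul_pow, h]
  rcases lt_trichotomy x 0 with hx | hx | hx
  · rw [Real.sign_of_neg hx]; ring
  · rw [hx, abs_zero, Real.zero_rpow (by norm_num), mul_zero]
  · rw [Real.sign_of_pos hx]; ring

/-- The interaction depends on a spin `t` through `modelSpin t`, a rescaled odd seventh root:
`modelK t u = 1 + modelSpin t * modelSpin u / 2`. -/
def modelSpin (t : unitInterval) : ℝ := seventhRoot (2 * (t : ℝ) - 1)

theorem modelK_eq (t u : unitInterval) : modelK t u = 1 + 1 / 2 * (modelSpin t * modelSpin u) := by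
  rw [modelK, modelSpin, modelSpin, ← seventhRoot_mul]
  congr 3
  ring

theorem measurable_modelSpin : Measurable modelSpin :=
  measurable_seventhRoot.comp (by fun_prop)

theorem modelSpin_symm (t : unitInterval) : modelSpin (unitInterval.symm t) = -modelSpin t := by
  rw [modelSpin, modelSpin, ← seventhRoot_neg, unitInterval.coe_symm_eq]
  congr 1
  ring

theorem abs_modelSpin_le (t : unitInterval) : |modelSpin t| ≤ 1 := by
  have h := seventhRoot_pow (2 * (t : ℝ) - 1)
  have hb : |2 * (t : ℝ) - 1| ≤ 1 := by
    rw [abs_le]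
    constructor <;> linarith [t.2.1, t.2.2]
  rw [← h, abs_pow] at hb
  exact (pow_le_one_iff_of_nonneg (abs_nonneg _) (by norm_num)).1 hb

theorem integrable_modelSpin_pow (n : ℕ) : Integrable fun t => modelSpin t ^ n :=
  Integrable.of_bound (measurable_modelSpin.pow_const n).aestronglyMeasurable 1
    (ae_of_all _ fun t => by
      rw [norm_pow, Real.norm_eq_abs]
      exact pow_le_one₀ (abs_nonneg _) (abs_modelSpin_le t))

theorem integral_modelSpin_pow_odd {n : ℕ} (hn : Odd n) : ∫ t, modelSpin t ^ n = 0 := by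
  have h := (unitInterval.measurePreserving_symm).integral_comp
    unitInterval.symmMeasurableEquiv.measurableEmbedding (fun t => modelSpin t ^ n)
  simp only [modelSpin_symm, hn.neg_pow, integral_neg] at h
  linarith

theorem integral_abs_two_mul_sub_one_rpow {p : ℝ} (hp : 0 ≤ p) :
    ∫ t : unitInterval, |2 * (t : ℝ) - 1| ^ p = 1 / (p + 1) := by
  have hc : Continuous fun x : ℝ => |x| ^ p := continuous_abs.rpow_const fun _ => Or.inr hp
  have h1 : ∫ x in (0 : ℝ)..1, |x| ^ p = 1 / (p + 1) := by
    rw [intervalIntegral.integral_congr (g := fun x : ℝ => x ^ p) fun x hx => by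
      rw [Set.uIcc_of_le zero_le_one] at hx
      simp only [abs_of_nonneg hx.1],
      integral_rpow (Or.inl (by linarith)), Real.one_rpow, Real.zero_rpow (by linarith), sub_zero]
  have h2 : ∫ x in (-1 : ℝ)..0, |x| ^ p = 1 / (p + 1) := by
    have := intervalIntegral.integral_comp_neg (a := (0 : ℝ)) (b := 1) fun x : ℝ => |x| ^ p
    simp only [abs_neg, neg_zero] at this
    rw [← this, h1]
  rw [integral_subtype (s := Set.Icc (0 : ℝ) 1) measurableSet_Icc fun x : ℝ => |2 * x - 1| ^ p,
    integral_Icc_eq_integral_Ioc, ← intervalIntegral.integral_of_le zero_le_one,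
    intervalIntegral.integral_comp_mul_sub (fun x : ℝ => |x| ^ p) two_ne_zero 1]
  norm_num only [smul_eq_mul, mul_zero, zero_sub, mul_one]
  rw [← intervalIntegral.integral_add_adjacent_intervals (b := 0) (hc.intervalIntegrable _ _)
    (hc.intervalIntegrable _ _), h1, h2]
  ring

theorem integral_modelSpin_sq : ∫ t, modelSpin t ^ 2 = 7 / 9 := by
  simp only [modelSpin, sq_seventhRoot]
  rw [integral_abs_two_mul_sub_one_rpow (by norm_num)]
  norm_num

theorem integral_modelSpin_pow_four : ∫ t, modelSpin t ^ 4 = 7 / 11 := by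
  have h : ∀ x : ℝ, seventhRoot x ^ 4 = |x| ^ (4 / 7 : ℝ) := fun x => by
    rw [show 4 = 2 * 2 from rfl, pow_mul, sq_seventhRoot, ← Real.rpow_natCast,
      ← Real.rpow_mul (abs_nonneg x)]
    norm_num
  simp only [modelSpin, h]
  rw [integral_abs_two_mul_sub_one_rpow (by norm_num)]
  norm_num

/-- Only the even moments of `modelSpin` contribute to the integral of a polynomial in it. -/
theorem integral_modelSpin_poly (c₀ c₁ c₂ c₃ c₄ c₅ : ℝ) :
    ∫ t, (c₀ + c₁ * modelSpin t ^ 1 + c₂ * modelSpin t ^ 2 + c₃ * modelSpin t ^ 3 +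
      c₄ * modelSpin t ^ 4 + c₅ * modelSpin t ^ 5) = c₀ + 7 / 9 * c₂ + 7 / 11 * c₄ := by
  have hi : ∀ (c : ℝ) (n : ℕ), Integrable fun t => c * modelSpin t ^ n := fun c n =>
    (integrable_modelSpin_pow n).const_mul c
  have h0 : Integrable (fun _ : unitInterval => c₀) := integrable_const c₀
  have h1 : Integrable fun t => c₀ + c₁ * modelSpin t ^ 1 :=
    h0.add (hi c₁ 1)
  have h2 : Integrable fun t => c₀ + c₁ * modelSpin t ^ 1 + c₂ * modelSpin t ^ 2 :=
    h1.add (hi c₂ 2)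
  have h3 : Integrable fun t =>
      c₀ + c₁ * modelSpin t ^ 1 + c₂ * modelSpin t ^ 2 + c₃ * modelSpin t ^ 3 :=
    h2.add (hi c₃ 3)
  have h4 : Integrable fun t => c₀ + c₁ * modelSpin t ^ 1 + c₂ * modelSpin t ^ 2 +
      c₃ * modelSpin t ^ 3 + c₄ * modelSpin t ^ 4 :=
    h3.add (hi c₄ 4)
  rw [integral_add h4 (hi c₅ 5), integral_add h3 (hi c₄ 4), integral_add h2 (hi c₃ 3),
    integral_add h1 (hi c₂ 2), integral_add h0 (hi c₁ 1)]
  simp only [integral_const_mul, integral_modelSpin_sq, integral_modelSpin_pow_four,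
    integral_modelSpin_pow_odd (show Odd 1 by decide),
    integral_modelSpin_pow_odd (show Odd 3 by decide),
    integral_modelSpin_pow_odd (show Odd 5 by decide), integral_const, probReal_univ, one_smul]
  ring

/-- The lower integral of a nonnegative polynomial in `modelSpin`. -/
theorem lintegral_modelSpin_poly {F : unitInterval → ℝ} (hF : ∀ t, 0 ≤ F t)
    (c₀ c₁ c₂ c₃ c₄ c₅ : ℝ) (h : ∀ t, F t = c₀ + c₁ * modelSpin t ^ 1 + c₂ * modelSpin t ^ 2 +
      c₃ * modelSpin t ^ 3 + c₄ * modelSpin t ^ 4 + c₅ * modelSpin t ^ 5) :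
    ∫⁻ t, ENNReal.ofReal (F t) = ENNReal.ofReal (c₀ + 7 / 9 * c₂ + 7 / 11 * c₄) := by
  rw [← integral_modelSpin_poly c₀ c₁ c₂ c₃ c₄ c₅, ← ofReal_integral_eq_lintegral_ofReal _
    (ae_of_all _ hF), integral_congr_ae (ae_of_all _ h)]
  rw [funext h]
  exact (((((integrable_const c₀).add ((integrable_modelSpin_pow 1).const_mul c₁)).add
    ((integrable_modelSpin_pow 2).const_mul c₂)).add
    ((integrable_modelSpin_pow 3).const_mul c₃)).add
    ((integrable_modelSpin_pow 4).const_mul c₄)).add ((integrable_modelSpin_pow 5).const_mul c₅)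

/-! ### Two boundary laws of the model -/

theorem modelPotential_bondWeight {β : ℝ} (hβ : 0 < β) (t u : unitInterval) :
    (modelPotential β).bondWeight β t u = ENNReal.ofReal (modelK t u) := by
  have hK : 0 < modelK t u := by linarith [(modelK_mem t u).1]
  have h : -β * (-(1 / β) * Real.log (modelK t u)) = Real.log (modelK t u) := by
    field_simp
  rw [PairPotential.bondWeight, modelPotential, h, Real.exp_log hK]

theorem one_add_mul_modelSpin_nonneg {a : ℝ} (ha : |a| ≤ 1) (t : unitInterval) :
    0 ≤ 1 + a * modelSpin t := by
  have h : |a * modelSpin t| ≤ 1 := by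
    rw [abs_mul]
    exact mul_le_one₀ ha (abs_nonneg _) (abs_modelSpin_le t)
  linarith [(abs_le.1 h).1]

theorem lintegral_one_add_mul_modelSpin_pow_four {a : ℝ} (ha : |a| ≤ 1) :
    ∫⁻ t, ENNReal.ofReal (1 + a * modelSpin t) ^ (3 + 1) =
      ENNReal.ofReal (1 + 7 / 9 * (6 * a ^ 2) + 7 / 11 * a ^ 4) := by
  simp_rw [← ENNReal.ofReal_pow (one_add_mul_modelSpin_nonneg ha _)]
  refine lintegral_modelSpin_poly (fun t => pow_nonneg (one_add_mul_modelSpin_nonneg ha t) _)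
    1 (4 * a) (6 * a ^ 2) (4 * a ^ 3) (a ^ 4) 0 fun t => ?_
  ring

/-- The functions `1 + a * modelSpin` that are boundary laws. As
`∫ modelK t u (1 + a ψ u) ^ 3 du = 1 + 3 a² m₂ + (3 a m₂ + a³ m₄) ψ t / 2`, with the moments
`m₂ = 7/9` and `m₄ = 7/11` of `ψ = modelSpin`, the condition is `133 a ^ 3 = 11 a`. -/
def modelBoundaryLaw {β : ℝ} (hβ : 0 < β) {a : ℝ} (ha : |a| ≤ 1) (h : 133 * a ^ 3 = 11 * a) :
    BoundaryLaw (modelPotential β) β 3 where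
  toFun t := ENNReal.ofReal (1 + a * modelSpin t)
  measurable := ((measurable_modelSpin.const_mul a).const_add 1).ennreal_ofReal
  eigenvalue := ENNReal.ofReal (1 + 7 / 3 * a ^ 2)
  eigenvalue_ne_zero := (ENNReal.ofReal_pos.2 (by positivity)).ne'
  eigenvalue_ne_top := ENNReal.ofReal_ne_top
  law t := by
    have hK : ∀ u, 0 ≤ modelK t u := fun u => by linarith [(modelK_mem t u).1]
    simp_rw [modelPotential_bondWeight hβ, ← ENNReal.ofReal_pow
      (one_add_mul_modelSpin_nonneg ha _), ← ENNReal.ofReal_mul (hK _)]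
    rw [← ENNReal.ofReal_mul (by positivity), lintegral_modelSpin_poly
      (fun u => mul_nonneg (hK u) (pow_nonneg (one_add_mul_modelSpin_nonneg ha u) _))
      1 (3 * a + 1 / 2 * modelSpin t) (3 * a ^ 2 + 3 / 2 * a * modelSpin t)
      (a ^ 3 + 3 / 2 * a ^ 2 * modelSpin t) (1 / 2 * a ^ 3 * modelSpin t) 0 fun u => by
        rw [modelK_eq]; ring]
    congr 1
    linear_combination (-1 / 66 * modelSpin t) * h
  mass_ne_zero := by
    rw [lintegral_one_add_mul_modelSpin_pow_four ha]
    exact (ENNReal.ofReal_pos.2 (by positivity)).ne'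
  mass_ne_top := by
    rw [lintegral_one_add_mul_modelSpin_pow_four ha]
    exact ENNReal.ofReal_ne_top

/-- The expectation of `1 + modelSpin (σ x)` in the splitting measure of `1 + a * modelSpin`,
multiplied by the normalising constant. -/
theorem lintegral_one_add_modelSpin {V : Type*} {G : SimpleGraph V} [G.LocallyFinite]
    (hG : IsCayleyTree 3 G) {β : ℝ} (hβ : 0 < β) {a : ℝ} (ha : |a| ≤ 1)
    (h : 133 * a ^ 3 = 11 * a) {μ : Measure (V → unitInterval)}
    (hμ : (modelBoundaryLaw hβ ha h).IsSplittingMeasure G μ) (x : V) :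
    ENNReal.ofReal (1 + 7 / 9 * (6 * a ^ 2) + 7 / 11 * a ^ 4) *
        ∫⁻ σ, ENNReal.ofReal (1 + modelSpin (σ x)) ∂μ =
      ENNReal.ofReal (1 + 7 / 9 * (6 * a ^ 2 + 4 * a) + 7 / 11 * (a ^ 4 + 4 * a ^ 3)) := by
  classical
  have hpos : 0 < 1 + 7 / 9 * (6 * a ^ 2) + 7 / 11 * a ^ 4 := by positivity
  have h1 : ∀ t, 0 ≤ 1 + modelSpin t := fun t => by linarith [(abs_le.1 (abs_modelSpin_le t)).1]
  have hm : Measurable fun t => ENNReal.ofReal (1 + modelSpin t) :=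
    (measurable_modelSpin.const_add 1).ennreal_ofReal
  have hx : (G.induce (({x} : Finset V) : Set V)).Connected := by
    rw [Finset.coe_singleton]
    exact SimpleGraph.Connected.of_subsingleton
  have hpoly : ∫⁻ t, ENNReal.ofReal (1 + modelSpin t) *
        ENNReal.ofReal (1 + a * modelSpin t) ^ (3 + 1) =
      ENNReal.ofReal (1 + 7 / 9 * (6 * a ^ 2 + 4 * a) + 7 / 11 * (a ^ 4 + 4 * a ^ 3)) := by
    simp_rw [← ENNReal.ofReal_pow (one_add_mul_modelSpin_nonneg ha _), ← ENNReal.ofReal_mul (h1 _)]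
    refine lintegral_modelSpin_poly
      (fun t => mul_nonneg (h1 t) (pow_nonneg (one_add_mul_modelSpin_nonneg ha t) _))
      1 (4 * a + 1) (6 * a ^ 2 + 4 * a) (4 * a ^ 3 + 6 * a ^ 2) (a ^ 4 + 4 * a ^ 3) (a ^ 4)
      fun t => ?_
    ring
  have hmx : Measurable fun σ : V → unitInterval => ENNReal.ofReal (1 + modelSpin (σ x)) :=
    hm.comp (measurable_pi_apply x)
  rw [hμ {x} hx _ hmx (fun σ τ hστ => by simp only [hστ x (by simp)]) fun _ => 0,
    lmarginal_singleton]
  simp_rw [(modelBoundaryLaw hβ ha h).density_singleton hG, Function.update_self]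
  simp only [modelBoundaryLaw, lintegral_one_add_mul_modelSpin_pow_four ha]
  rw [← hpoly, ← lintegral_const_mul]
  · refine lintegral_congr fun t => ?_
    rw [mul_left_comm (ENNReal.ofReal (1 + modelSpin t)), ← mul_assoc, ENNReal.mul_inv_cancel
      (ENNReal.ofReal_pos.2 hpos).ne' ENNReal.ofReal_ne_top, one_mul]
  · exact hm.mul ((((measurable_modelSpin.const_mul a).const_add 1).ennreal_ofReal.pow_const
      _).const_mul _)

end

theorem theorem4p2 {V : Type*} (G : SimpleGraph V) [G.LocallyFinite] (hG : IsCayleyTree 3 G)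
    (β : ℝ) (hβ : 0 < β) :
    ∃ μ₁ μ₂ : Measure (V → unitInterval), μ₁ ≠ μ₂ ∧
      ((modelPotential β).IsGibbsMeasure G β μ₁ ∧ IsTranslationInvariant G μ₁) ∧
      ((modelPotential β).IsGibbsMeasure G β μ₂ ∧ IsTranslationInvariant G μ₂) := by
  have hconn := hG.1.connected
  obtain ⟨x⟩ := hconn.nonempty
  -- The nonzero solution of `133 a ^ 3 = 11 a`.
  obtain ⟨a, ha0, ha1, ha⟩ : ∃ a : ℝ, 0 < a ∧ |a| ≤ 1 ∧ 133 * a ^ 3 = 11 * a := by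
    have hs : Real.sqrt (11 / 133) ^ 2 = 11 / 133 := Real.sq_sqrt (by norm_num)
    refine ⟨Real.sqrt (11 / 133), Real.sqrt_pos.2 (by norm_num), ?_, ?_⟩
    · rw [abs_of_nonneg (Real.sqrt_nonneg _), Real.sqrt_le_one]
      norm_num
    · rw [pow_succ, hs]
      ring
  have hz1 : |(0 : ℝ)| ≤ 1 := by simp
  have hz : 133 * (0 : ℝ) ^ 3 = 11 * 0 := by norm_num
  obtain ⟨μ₁, hp₁, hμ₁⟩ := (modelBoundaryLaw hβ hz1 hz).exists_isSplittingMeasure hG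
  obtain ⟨μ₂, hp₂, hμ₂⟩ := (modelBoundaryLaw hβ ha1 ha).exists_isSplittingMeasure hG
  refine ⟨μ₁, μ₂, ?_, ⟨hμ₁.isGibbsMeasure hconn, hμ₁.isTranslationInvariant hconn⟩,
    ⟨hμ₂.isGibbsMeasure hconn, hμ₂.isTranslationInvariant hconn⟩⟩
  rintro rfl
  have e₁ := lintegral_one_add_modelSpin hG hβ hz1 hz hμ₁ x
  have e₂ := lintegral_one_add_modelSpin hG hβ ha1 ha hμ₂ x
  norm_num at e₁
  rw [e₁, mul_one, ENNReal.ofReal_eq_ofReal_iff (by positivity) (by positivity)] at e₂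
  have : 0 < a ^ 3 := by positivity
  linarith
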